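/- Let $\phi:\mathcal X\to\mathbb R^d$ be a feature map and $c_1,\dots,c_R\in\mathbb R^d$ fixed centroids, and let every sample $x\in\mathcal X$ belong to the cluster of a centroid nearest to $\phi(x)$ (ties broken in any fixed way). Let $n\in\mathbb N$ and let $\gamma,\sigma,\delta$ be positive real numbers with $$\gamma\le\min\left\{0.1,\ \sigma\sqrt{\log(1/\delta)/6}\right\},\qquad \sigma\ge 2\sqrt5,\qquad \gamma n\ge 1,\qquad \log(1/\delta)\le\sigma^2 .$$ The ECOS scoring mechanism $\mathcal M$ draws $\lceil\gamma n\rceil$ samples independently and uniformly, with replacement, from a finite client dataset $X$, lets $v_r$ be the number of drawn samples (with multiplicity) in the cluster of $c_r$, and releases $\tilde v=(v_1,\dots,v_R)+\mathcal N(0,\sigma^2I)$, with noise independent of the draws. Call two datasets neighboring if both have $n$ samples and they differ by the exchange of one sample, or if one has $n$ samples and the other arises from it by deleting one sample (the number of draws being $\lceil\gamma n\rceil$ for both). Then $\mathcal M$ is $(\epsilon,\delta)$-differentially private, i.e. $\Pr[\mathcal M(X)\in Y]\le e^{\epsilon}\Pr[\mathcal M(X')\in Y]+\delta$ for all neighboring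 $X,X'$ and all measurable $Y\subseteq\mathbb R^R$, with $$\epsilon = 8\,\frac{\gamma}{\sigma}\sqrt{6\log(1/\delta)} .$$ In particular $\epsilon=O\!\left(\frac{\gamma}{\sigma}\sqrt{\log(1/\delta)}\right)$ with an absolute constant, independent of $R$, $d$ and $n$. -/

import Mathlib

open MeasureTheory ProbabilityTheory
open scoped ENNReal

noncomputable section

namespace ECOS

/-- A (possibly randomized) mechanism, given by the law `M X` of its output on each dataset `X`, is
`(ε, δ)`-differentially private for a neighboring relation. -/
def IsDP {D Y : Type*} [MeasurableSpace Y] (Neighbor : D → D → Prop) (M : D → Measure Y)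
    (ε δ : ℝ) : Prop :=
  ∀ X X' : D, Neighbor X X' → ∀ S : Set Y, MeasurableSet S →
    M X S ≤ ENNReal.ofReal (Real.exp ε) * M X' S + ENNReal.ofReal δ

/-- Two client datasets (finite lists of samples) are neighbors, the larger one having `n` samples:
one sample is exchanged for another one, or one sample is absent from one of the two datasets. -/
inductive Neighboring {𝒳 : Type*} (n : ℕ) : List 𝒳 → List 𝒳 → Prop
  | replace (l₁ l₂ : List 𝒳) (x x' : 𝒳) (h : (l₁ ++ x :: l₂).length = n) :
      Neighboring n (l₁ ++ x :: l₂) (l₁ ++ x' :: l₂)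
  | remove (l₁ l₂ : List 𝒳) (x : 𝒳) (h : (l₁ ++ x :: l₂).length = n) :
      Neighboring n (l₁ ++ x :: l₂) (l₁ ++ l₂)
  | insert (l₁ l₂ : List 𝒳) (x : 𝒳) (h : (l₁ ++ x :: l₂).length = n) :
      Neighboring n (l₁ ++ l₂) (l₁ ++ x :: l₂)

/-- `a x` is the cluster of the sample `x` in a partition of the samples by the centroids
`c 0, …, c (R - 1)`: the index of a centroid nearest to the feature `φ x`. Ties may be broken in
any way. -/
def IsCentroidPartition {𝒳 : Type*} {d R : ℕ} (φ : 𝒳 → EuclideanSpace ℝ (Fin d))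
    (c : Fin R → EuclideanSpace ℝ (Fin d)) (a : 𝒳 → Fin R) : Prop :=
  ∀ (x : 𝒳) (r : Fin R), ‖φ x - c (a x)‖ ≤ ‖φ x - c r‖

/-- The centroid coverage scores `v r = |C r|` of a tuple of `k` samples (a sample that occurs
several times is counted with multiplicity). -/
def coverage {𝒳 : Type*} {R k : ℕ} (a : 𝒳 → Fin R) (x : Fin k → 𝒳) (r : Fin R) : ℕ :=
  (Finset.univ.filter fun i => a (x i) = r).card

/-- The law of `k` independent uniform draws, with replacement, from `N` positions, i.e. the uniform
law on the tuples of `k` positions. -/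
def drawLaw (N k : ℕ) : Measure (Fin k → Fin N) :=
  uniformOn Set.univ

/-- The isotropic Gaussian law `N(0, σ² I)` on `ℝ^R`. -/
def noiseLaw (R : ℕ) (σ : ℝ) : Measure (Fin R → ℝ) :=
  Measure.pi fun _ => gaussianReal 0 (Real.toNNReal (σ ^ 2))

/-- The law of the noisy scores: draw `k` samples from `X` with replacement, compute their
centroid coverage scores, and add independent noise of law `N(0, σ² I)`. -/
def scoring {𝒳 : Type*} {R : ℕ} (a : 𝒳 → Fin R) (k : ℕ) (σ : ℝ) (X : List 𝒳) :
    Measure (Fin R → ℝ) :=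
  ((drawLaw X.length k).prod (noiseLaw R σ)).map
    fun p r => (coverage a (fun i => X.get (p.1 i)) r : ℝ) + p.2 r

end ECOS

end

/-!
A sample `x` of a dataset `X` of size `n` is hit by each of the `k = ⌈γ n⌉` draws with probability
`1 / n`, independently. Condition on what the draws would be if they were made from the dataset
without `x` (`scoring_insert_apply`): the noisy scores of the dataset without `x` are then a fixed
translate of the noise `N(0, σ² I)`, and those of `X` are a mixture of the laws `N(u_b, σ² I)`,
where `b` is the set of draws that hit `x`. The shift `u_b` is a difference of two nonnegative
vectors of sum `|b|`, so that `‖u_b‖² ≤ 2 |b|²` (`hitShift_dotProduct_self_le`), and `|b|` is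
binomial with mean `q = k / n ≤ 2 γ`. Exchanging `x` for `x'` replaces the shifts by others with
the same bound, and removing `x` replaces them by zero, so all cases are instances of one inequality
between two mixtures with the same weights, `IsRare.sum_shiftProb_le_exp_mul_add`.

If `δ ≥ 0.2`, the inequality holds because the mixtures coincide unless some draw hits, which has
probability at most `q ≤ 0.2`. If `δ < 0.2`, put `y = √(log (1 / δ)) / σ ≤ 1` and pass through the
law `N(0, σ² I)`.

* From the mixture to `N(0, σ² I)`: a shift of multiplicity `j = |b|` is compared with parameters
  `2 j y` and `δ exp (j y)` by a Chernoff bound (`shiftProb_le_of_dotProduct_le`). Averaging over the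
  binomial law of `j` gives the factor `exp (q (exp (2 y) - 1)) ≤ exp (12.8 γ y)` and an error below
  `0.62 δ` (`IsRare.sum_shiftProb_le`).
* From `N(0, σ² I)` to the mixture: by Jensen's inequality the density of the mixture is at least
  the exponential of an affine function, whose slope and constant term are of order `q / σ²`
  (`shiftProb_zero_le_sum_add`). So the logarithm of the ratio has Gaussian tails of width of order
  `γ / σ`, and it exceeds `6.79 γ y` only with a probability that contributes less than `0.37 δ`.

As `8 √6 > 12.8 + 6.79`, the two steps together stay within `ε`. No moment of high order of the
mixture density is involved, so there is no restriction on the Rényi order to take care of. In both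
steps the error terms are themselves multiples of Gaussian densities, so that only inequalities
between such densities have to be integrated (`shiftProb_le_sum_add`).
-/

noncomputable section

namespace ECOS

/-! ### Shifts of the isotropic Gaussian law -/

/-- The density of `N(u, σ² I)` with respect to `N(0, σ² I)`. -/
def tilt {R : ℕ} (σ : ℝ) (u z : Fin R → ℝ) : ℝ :=
  Real.exp ((u ⬝ᵥ z - u ⬝ᵥ u / 2) / σ ^ 2)

/-- The probability that `N(u, σ² I)` gives to the set `S`. -/
def shiftProb {R : ℕ} (σ : ℝ) (S : Set (Fin R → ℝ)) (u : Fin R → ℝ) : ℝ :=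
  ((noiseLaw R σ).map (u + ·)).real S

instance {R : ℕ} {σ : ℝ} : IsProbabilityMeasure (noiseLaw R σ) := by
  unfold noiseLaw; infer_instance

lemma gaussianReal_eq_withDensity {σ : ℝ} (hσ : 0 < σ) (m : ℝ) :
    gaussianReal m (Real.toNNReal (σ ^ 2)) =
      (gaussianReal 0 (Real.toNNReal (σ ^ 2))).withDensity
        fun x => ENNReal.ofReal (Real.exp ((m * x - m * m / 2) / σ ^ 2)) := by
  have hv : Real.toNNReal (σ ^ 2) ≠ 0 := by simpa using hσ.ne'
  rw [gaussianReal_of_var_ne_zero _ hv, gaussianReal_of_var_ne_zero _ hv,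
    ← withDensity_mul _ (measurable_gaussianPDF _ _) (by fun_prop)]
  congr 1
  ext x
  rw [Pi.mul_apply, gaussianPDF, gaussianPDF, ← ENNReal.ofReal_mul (gaussianPDFReal_nonneg _ _ _),
    gaussianPDFReal, gaussianPDFReal, mul_assoc _ (Real.exp _) (Real.exp _), ← Real.exp_add,
    Real.coe_toNNReal _ (sq_nonneg σ)]
  congr 3
  field_simp
  ring

lemma integrable_exp_gaussianReal (σ m : ℝ) :
    Integrable (fun x => Real.exp ((m * x - m * m / 2) / σ ^ 2))
      (gaussianReal 0 (Real.toNNReal (σ ^ 2))) := by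
  have h2 : (fun x : ℝ => Real.exp ((m * x - m * m / 2) / σ ^ 2)) =
      fun x => Real.exp (m / σ ^ 2 * x) * Real.exp (-(m * m / 2) / σ ^ 2) := by
    ext x
    rw [← Real.exp_add]
    congr 1
    ring
  rw [h2]
  exact (integrable_exp_mul_gaussianReal _).mul_const _

lemma tilt_eq_prod {R : ℕ} (σ : ℝ) (u z : Fin R → ℝ) :
    tilt σ u z = ∏ r, Real.exp ((u r * z r - u r * u r / 2) / σ ^ 2) := by
  rw [tilt, ← Real.exp_sum, dotProduct, dotProduct, Finset.sum_div, ← Finset.sum_sub_distrib,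
    Finset.sum_div]

lemma integrable_tilt {R : ℕ} (σ : ℝ) (u : Fin R → ℝ) :
    Integrable (tilt σ u) (noiseLaw R σ) := by
  have h : tilt σ u = fun z => ∏ r, Real.exp ((u r * z r - u r * u r / 2) / σ ^ 2) :=
    funext (tilt_eq_prod σ u)
  rw [h]
  refine Integrable.fintype_prod (f := fun r x => Real.exp ((u r * x - u r * u r / 2) / σ ^ 2))
    fun r => integrable_exp_gaussianReal σ (u r)

lemma noiseLaw_map_add_left {R : ℕ} {σ : ℝ} (hσ : 0 < σ) (u : Fin R → ℝ) :
    (noiseLaw R σ).map (u + ·) =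
      (noiseLaw R σ).withDensity fun z => ENNReal.ofReal (tilt σ u z) := by
  have hmap : (noiseLaw R σ).map (u + ·) =
      Measure.pi fun r => gaussianReal (u r) (Real.toNNReal (σ ^ 2)) := by
    have h := Measure.pi_map_pi (μ := fun _ : Fin R => gaussianReal 0 (Real.toNNReal (σ ^ 2)))
      (f := fun r x => u r + x) (fun r => (measurable_const_add _).aemeasurable)
    simp only [gaussianReal_map_const_add, zero_add] at h
    exact h
  rw [hmap]
  refine Measure.pi_eq fun s hs => ?_
  rw [withDensity_apply _ (MeasurableSet.univ_pi hs),
    ← ofReal_integral_eq_lintegral_ofReal (integrable_tilt σ u).integrableOn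
      (Filter.Eventually.of_forall fun z => (Real.exp_pos _).le)]
  simp_rw [tilt_eq_prod]
  rw [noiseLaw, Measure.restrict_pi_pi,
    integral_fintype_prod_eq_prod (fun r x => Real.exp ((u r * x - u r * u r / 2) / σ ^ 2)),
    ENNReal.ofReal_prod_of_nonneg fun r _ => integral_nonneg fun x => (Real.exp_pos _).le]
  refine Finset.prod_congr rfl fun r _ => ?_
  rw [gaussianReal_eq_withDensity hσ (u r), withDensity_apply _ (hs r),
    ofReal_integral_eq_lintegral_ofReal _
      (Filter.Eventually.of_forall fun z => (Real.exp_pos _).le)]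
  exact (integrable_exp_gaussianReal σ (u r)).integrableOn

lemma shiftProb_eq_integral {R : ℕ} {σ : ℝ} (hσ : 0 < σ) {S : Set (Fin R → ℝ)}
    (hS : MeasurableSet S) (u : Fin R → ℝ) :
    shiftProb σ S u = ∫ z in S, tilt σ u z ∂noiseLaw R σ := by
  rw [shiftProb, Measure.real, noiseLaw_map_add_left hσ, withDensity_apply _ hS,
    ← ofReal_integral_eq_lintegral_ofReal (integrable_tilt σ u).integrableOn
      (Filter.Eventually.of_forall fun z => (Real.exp_pos _).le),
    ENNReal.toReal_ofReal (integral_nonneg (f := tilt σ u) fun z => (Real.exp_pos _).le)]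

lemma shiftProb_nonneg {R : ℕ} (σ : ℝ) (S : Set (Fin R → ℝ)) (u : Fin R → ℝ) :
    0 ≤ shiftProb σ S u := measureReal_nonneg

lemma shiftProb_le_one {R : ℕ} (σ : ℝ) (S : Set (Fin R → ℝ)) (u : Fin R → ℝ) :
    shiftProb σ S u ≤ 1 := by
  have : IsProbabilityMeasure ((noiseLaw R σ).map (u + ·)) :=
    Measure.isProbabilityMeasure_map (measurable_const_add u).aemeasurable
  exact measureReal_le_one

lemma shiftProb_add {R : ℕ} (σ : ℝ) {S : Set (Fin R → ℝ)} (hS : MeasurableSet S)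
    (u v : Fin R → ℝ) : shiftProb σ S (u + v) = shiftProb σ ((u + ·) ⁻¹' S) v := by
  have hT : MeasurableSet ((u + ·) ⁻¹' S) := measurable_const_add u hS
  rw [shiftProb, shiftProb, map_measureReal_apply (measurable_const_add _) hS,
    map_measureReal_apply (measurable_const_add _) hT]
  simp only [Set.preimage_preimage, add_assoc]

/-- A pointwise inequality between Gaussian densities, the error term of which is a multiple of a
Gaussian density, integrates to an inequality with an additive error. -/
lemma shiftProb_le_sum_add {ι : Type*} [Fintype ι] {R : ℕ} {σ : ℝ} (hσ : 0 < σ)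
    {S : Set (Fin R → ℝ)} (hS : MeasurableSet S) {a : ι → ℝ} {β : ℝ} (hβ : 0 ≤ β)
    {u w : Fin R → ℝ} {v : ι → Fin R → ℝ}
    (h : ∀ z, tilt σ u z ≤ ∑ i, a i * tilt σ (v i) z + β * tilt σ w z) :
    shiftProb σ S u ≤ ∑ i, a i * shiftProb σ S (v i) + β := by
  have hint : ∀ v : Fin R → ℝ, Integrable (tilt σ v) ((noiseLaw R σ).restrict S) :=
    fun v => (integrable_tilt σ v).restrict
  have hsum : Integrable (fun z => ∑ i, a i * tilt σ (v i) z) ((noiseLaw R σ).restrict S) :=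
    integrable_finsetSum _ fun i _ => (hint _).const_mul _
  calc shiftProb σ S u = ∫ z in S, tilt σ u z ∂noiseLaw R σ := shiftProb_eq_integral hσ hS u
    _ ≤ ∫ z in S, (∑ i, a i * tilt σ (v i) z + β * tilt σ w z) ∂noiseLaw R σ :=
        integral_mono (hint u) (hsum.add ((hint w).const_mul β)) h
    _ = ∑ i, a i * shiftProb σ S (v i) + β * shiftProb σ S w := by
        rw [integral_add hsum ((hint w).const_mul β),
          integral_finsetSum _ fun i _ => (hint _).const_mul _]
        simp only [integral_const_mul, shiftProb_eq_integral hσ hS]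
    _ ≤ _ := by
        gcongr
        exact mul_le_of_le_one_right hβ (shiftProb_le_one σ S w)

/-- A single shift: if `‖u‖² ≤ 2 j²`, the laws `N(u, σ² I)` and `N(0, σ² I)` satisfy the
differential privacy inequality with `ε = 2 j y` and additive error `exp (j y - y² σ²)`. -/
lemma shiftProb_le_of_dotProduct_le {R : ℕ} {σ : ℝ} (hσ : 0 < σ) {S : Set (Fin R → ℝ)}
    (hS : MeasurableSet S) {u : Fin R → ℝ} {j : ℕ} (hj : j ≠ 0) (hu : u ⬝ᵥ u ≤ 2 * (j : ℝ) ^ 2)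
    {y : ℝ} (hy : 0 < y) :
    shiftProb σ S u ≤
      Real.exp (2 * y) ^ j * shiftProb σ S 0 + Real.exp (-(y ^ 2 * σ ^ 2)) * Real.exp y ^ j := by
  have hj' : (0 : ℝ) < j := by exact_mod_cast Nat.pos_of_ne_zero hj
  -- The order of the Chernoff bound; it minimizes `s² j² / σ² - 2 s j y`.
  set s : ℝ := y * σ ^ 2 / j with hs
  have hs0 : 0 < s := by positivity
  have key := shiftProb_le_sum_add (ι := Unit) hσ hS (u := u) (w := (1 + s) • u)
    (v := fun _ => 0) (a := fun _ => Real.exp (2 * y) ^ j)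
    (β := Real.exp (-(y ^ 2 * σ ^ 2)) * Real.exp y ^ j) (by positivity) ?_
  · simpa using key
  intro z
  simp only [tilt, Finset.univ_unique, Finset.sum_singleton, zero_dotProduct, dotProduct_zero,
    smul_dotProduct, dotProduct_smul, smul_eq_mul, zero_div, sub_zero, Real.exp_zero, mul_one,
    ← Real.exp_nat_mul, ← Real.exp_add]
  -- Below the threshold the density ratio is at most `exp (2 j y)`; above it, it is at most its
  -- `(1 + s)`-th power divided by the `s`-th power of the threshold, a multiple of another tilt.
  rcases le_total ((u ⬝ᵥ z - u ⬝ᵥ u / 2) / σ ^ 2) (j * (2 * y)) with h | h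
  · exact (Real.exp_le_exp.2 h).trans (le_add_of_nonneg_right (Real.exp_pos _).le)
  · refine (Real.exp_le_exp.2 ?_).trans (le_add_of_nonneg_left (Real.exp_pos _).le)
    have hsj : s * j = y * σ ^ 2 := by rw [hs]; field_simp
    have h1 : s * (j * (2 * y)) ≤ s * ((u ⬝ᵥ z - u ⬝ᵥ u / 2) / σ ^ 2) :=
      mul_le_mul_of_nonneg_left h hs0.le
    have h2 : s * (1 + s) * (u ⬝ᵥ u) / (2 * σ ^ 2) ≤ j * y + y ^ 2 * σ ^ 2 := by
      rw [div_le_iff₀ (by positivity)]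
      calc s * (1 + s) * (u ⬝ᵥ u) ≤ s * (1 + s) * (2 * (j : ℝ) ^ 2) := by gcongr
        _ = 2 * (s * j) * j + 2 * (s * j) ^ 2 := by ring
        _ = _ := by rw [hsj]; ring
    have h3 : s * (j * (2 * y)) = 2 * (y ^ 2 * σ ^ 2) := by
      linear_combination 2 * y * hsj
    have h4 : ((1 + s) * (u ⬝ᵥ z) - (1 + s) * ((1 + s) * (u ⬝ᵥ u)) / 2) / σ ^ 2 =
        (u ⬝ᵥ z - u ⬝ᵥ u / 2) / σ ^ 2 + s * ((u ⬝ᵥ z - u ⬝ᵥ u / 2) / σ ^ 2) -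
          s * (1 + s) * (u ⬝ᵥ u) / (2 * σ ^ 2) := by
      field_simp
      ring
    rw [h4]
    linarith

/-- By Jensen's inequality the density of a mixture of shifts is at least the exponential of the
averaged log-density, which is an affine function; a Chernoff bound of order `s` for that function
bounds the unshifted law by the mixture. -/
lemma shiftProb_zero_le_sum_add {ι : Type*} [Fintype ι] {R : ℕ} {σ : ℝ} (hσ : 0 < σ)
    {S : Set (Fin R → ℝ)} (hS : MeasurableSet S) {p : ι → ℝ} (hp : ∀ i, 0 ≤ p i)
    (hp1 : ∑ i, p i = 1) (u : ι → Fin R → ℝ) {s : ℝ} (hs : 0 ≤ s) (τ : ℝ) :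
    shiftProb σ S 0 ≤ Real.exp τ * ∑ i, p i * shiftProb σ S (u i) +
      Real.exp ((s * (∑ i, p i * (u i ⬝ᵥ u i)) +
        s ^ 2 * ((∑ i, p i • u i) ⬝ᵥ (∑ i, p i • u i))) / (2 * σ ^ 2) - s * τ) := by
  set m := ∑ i, p i • u i with hm
  set M := ∑ i, p i * (u i ⬝ᵥ u i) with hM
  have key := shiftProb_le_sum_add hσ hS (u := 0) (w := (-s) • m)
    (v := u) (a := fun i => Real.exp τ * p i)
    (β := Real.exp ((s * M + s ^ 2 * (m ⬝ᵥ m)) / (2 * σ ^ 2) - s * τ)) (by positivity) ?_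
  · simpa only [Finset.mul_sum, mul_assoc] using key
  intro z
  have hJ : Real.exp ((m ⬝ᵥ z - M / 2) / σ ^ 2) ≤ ∑ i, p i * tilt σ (u i) z := by
    have h := convexOn_exp.map_sum_le (t := Finset.univ) (w := p)
      (p := fun i => (u i ⬝ᵥ z - u i ⬝ᵥ u i / 2) / σ ^ 2) (fun i _ => hp i) hp1
      (fun i _ => Set.mem_univ _)
    simp only [smul_eq_mul] at h
    refine le_trans (le_of_eq ?_) h
    congr 1
    rw [hm, hM, sum_dotProduct, Finset.sum_div, ← Finset.sum_sub_distrib, Finset.sum_div]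
    refine Finset.sum_congr rfl fun i _ => ?_
    rw [smul_dotProduct, smul_eq_mul]
    ring
  have h0 : tilt σ 0 z = 1 := by simp [tilt]
  have hsum : ∑ i, Real.exp τ * p i * tilt σ (u i) z =
      Real.exp τ * ∑ i, p i * tilt σ (u i) z := by
    simp only [Finset.mul_sum, mul_assoc]
  rw [h0, hsum]
  rcases le_total 0 (τ + (m ⬝ᵥ z - M / 2) / σ ^ 2) with h | h
  · refine le_add_of_le_of_nonneg ?_ (mul_nonneg (Real.exp_pos _).le (Real.exp_pos _).le)
    calc (1 : ℝ) ≤ Real.exp (τ + (m ⬝ᵥ z - M / 2) / σ ^ 2) := Real.one_le_exp h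
      _ = Real.exp τ * Real.exp ((m ⬝ᵥ z - M / 2) / σ ^ 2) := Real.exp_add _ _
      _ ≤ _ := by gcongr
  · refine le_add_of_nonneg_of_le (mul_nonneg (Real.exp_pos _).le
      (Finset.sum_nonneg fun i _ => mul_nonneg (hp i) (Real.exp_pos _).le)) ?_
    rw [tilt, ← Real.exp_add]
    refine Real.one_le_exp ?_
    simp only [smul_dotProduct, dotProduct_smul, smul_eq_mul]
    have h5 : (s * M + s ^ 2 * (m ⬝ᵥ m)) / (2 * σ ^ 2) - s * τ +
        (-s * (m ⬝ᵥ z) - -s * (-s * (m ⬝ᵥ m)) / 2) / σ ^ 2 =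
        s * -(τ + (m ⬝ᵥ z - M / 2) / σ ^ 2) := by
      field_simp
      ring
    rw [h5]
    exact mul_nonneg hs (by linarith)

/-! ### Mixtures of shifts with a rare multiplicity -/

/-- The weights `p` form a probability vector, under which the multiplicity `j` has a generating
function that is dominated by that of the Poisson law of mean `q`, and vanishes with probability
at least `1 - q`. -/
structure IsRare {ι : Type*} [Fintype ι] (q : ℝ) (p : ι → ℝ) (j : ι → ℕ) : Prop where
  nonneg : ∀ i, 0 ≤ p i
  sum_eq_one : ∑ i, p i = 1
  sum_mul_pow_le : ∀ t : ℝ, 0 ≤ t → ∑ i, p i * t ^ j i ≤ Real.exp (q * (t - 1))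
  -- Here `0 ^ j i` is the indicator of `j i = 0`.
  one_sub_le : 1 - q ≤ ∑ i, p i * 0 ^ j i

namespace IsRare

variable {ι : Type*} [Fintype ι] {q : ℝ} {p : ι → ℝ} {j : ι → ℕ}

/-- The mean multiplicity, by Bernoulli's inequality `1 + 0.1 j ≤ 1.1 ^ j`. The base is close to `1` so
that the bound is close to `q`. -/
lemma sum_mul_le (h : IsRare q p j) :
    ∑ i, p i * (j i : ℝ) ≤ 10 * (Real.exp (q / 10) - 1) := by
  have h1 : ∀ i, p i * (j i : ℝ) ≤ 10 * (p i * (1.1 : ℝ) ^ j i) - 10 * p i := fun i => by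
    have hb := one_add_mul_le_pow (a := (0.1 : ℝ)) (by norm_num) (j i)
    norm_num at hb ⊢
    nlinarith [h.nonneg i]
  refine (Finset.sum_le_sum fun i _ => h1 i).trans ?_
  rw [Finset.sum_sub_distrib, ← Finset.mul_sum, ← Finset.mul_sum, h.sum_eq_one]
  have h2 := h.sum_mul_pow_le 1.1 (by norm_num)
  rw [show q * (1.1 - 1) = q / 10 by ring] at h2
  linarith

/-- The second moment of the multiplicity, from the generating function at `3` and
`2 j ^ 2 ≤ 3 ^ j - 1`. -/
lemma sum_mul_sq_le (h : IsRare q p j) :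
    ∑ i, p i * (2 * (j i : ℝ) ^ 2) ≤ Real.exp (2 * q) - 1 := by
  have h0 : ∀ m : ℕ, 2 * (m : ℝ) + 1 ≤ 3 ^ m := fun m => by
    have := one_add_mul_le_pow (a := (2 : ℝ)) (by norm_num) m
    norm_num at this
    linarith
  have h1 : ∀ m : ℕ, 2 * (m : ℝ) ^ 2 ≤ 3 ^ m - 1 := fun m => by
    induction m with
    | zero => norm_num
    | succ m ih =>
      have := h0 m
      rw [pow_succ (3 : ℝ) m]
      push_cast
      linarith
  calc ∑ i, p i * (2 * (j i : ℝ) ^ 2) ≤ ∑ i, (p i * 3 ^ j i - p i) :=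
        Finset.sum_le_sum fun i _ => by nlinarith [h.nonneg i, h1 (j i)]
    _ = ∑ i, p i * 3 ^ j i - 1 := by rw [Finset.sum_sub_distrib, h.sum_eq_one]
    _ ≤ _ := by
        have h2 := h.sum_mul_pow_le 3 (by norm_num)
        rw [show q * (3 - 1) = 2 * q by ring] at h2
        linarith

variable {R : ℕ} {σ : ℝ} {S : Set (Fin R → ℝ)} {u u' : ι → Fin R → ℝ}

lemma eq_zero_of_dotProduct_le {v : Fin R → ℝ} (hv : v ⬝ᵥ v ≤ 2 * ((0 : ℕ) : ℝ) ^ 2) : v = 0 := by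
  rw [← dotProduct_self_eq_zero]
  refine le_antisymm (by simpa using hv) ?_
  exact Finset.sum_nonneg fun r _ => mul_self_nonneg _

/-- The total variation bound: mixtures that differ only where the multiplicity is nonzero. -/
lemma sum_shiftProb_le_add (h : IsRare q p j) (hu : ∀ i, u i ⬝ᵥ u i ≤ 2 * (j i : ℝ) ^ 2)
    (hu' : ∀ i, u' i ⬝ᵥ u' i ≤ 2 * (j i : ℝ) ^ 2) :
    ∑ i, p i * shiftProb σ S (u i) ≤ ∑ i, p i * shiftProb σ S (u' i) + q := by
  have h1 : ∀ i, p i * shiftProb σ S (u i) ≤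
      p i * shiftProb σ S (u' i) + (p i - p i * 0 ^ j i) := fun i => by
    have hi := hu i
    have hi' := hu' i
    rcases Nat.eq_zero_or_pos (j i) with h0 | h0
    · rw [h0] at hi hi'
      simp [eq_zero_of_dotProduct_le hi, eq_zero_of_dotProduct_le hi', h0]
    · rw [zero_pow h0.ne']
      nlinarith [h.nonneg i, shiftProb_le_one σ S (u i), shiftProb_nonneg σ S (u' i)]
  refine (Finset.sum_le_sum fun i _ => h1 i).trans ?_
  rw [Finset.sum_add_distrib, Finset.sum_sub_distrib, h.sum_eq_one]
  linarith [h.one_sub_le]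

/-- The mixture against its unshifted component: average the bounds for the single shifts. -/
lemma sum_shiftProb_le (h : IsRare q p j) (hσ : 0 < σ) (hS : MeasurableSet S)
    (hu : ∀ i, u i ⬝ᵥ u i ≤ 2 * (j i : ℝ) ^ 2) {y : ℝ} (hy : 0 < y) :
    ∑ i, p i * shiftProb σ S (u i) ≤
      Real.exp (q * (Real.exp (2 * y) - 1)) * shiftProb σ S 0 +
        Real.exp (-(y ^ 2 * σ ^ 2)) * (Real.exp (q * (Real.exp y - 1)) - (1 - q)) := by
  set G := shiftProb σ S 0 with hG
  set d := Real.exp (-(y ^ 2 * σ ^ 2)) with hd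
  -- The unshifted component contributes no error, which is the term `0 ^ j i`.
  have h1 : ∀ i, p i * shiftProb σ S (u i) ≤
      p i * Real.exp (2 * y) ^ j i * G + d * (p i * Real.exp y ^ j i - p i * 0 ^ j i) := fun i => by
    have hi := hu i
    rcases Nat.eq_zero_or_pos (j i) with h0 | h0
    · rw [h0] at hi
      simp [eq_zero_of_dotProduct_le hi, h0, hG]
    · rw [zero_pow h0.ne']
      have := mul_le_mul_of_nonneg_left (shiftProb_le_of_dotProduct_le hσ hS h0.ne' hi hy)
        (h.nonneg i)
      rw [← hG, ← hd] at this
      linarith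
  refine (Finset.sum_le_sum fun i _ => h1 i).trans ?_
  rw [Finset.sum_add_distrib, ← Finset.sum_mul, ← Finset.mul_sum, Finset.sum_sub_distrib]
  have := h.sum_mul_pow_le _ (Real.exp_pos (2 * y)).le
  have := h.sum_mul_pow_le _ (Real.exp_pos y).le
  have := h.one_sub_le
  gcongr
  exact shiftProb_nonneg σ S 0

/-- The squared norm of the mean shift, by the Cauchy–Schwarz inequality for each pair of shifts. This
keeps the square of the mean multiplicity, where convexity of the norm square would only give the
second moment. -/
lemma dotProduct_mean_le (h : IsRare q p j) (hu : ∀ i, u i ⬝ᵥ u i ≤ 2 * (j i : ℝ) ^ 2) :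
    (∑ i, p i • u i) ⬝ᵥ (∑ i, p i • u i) ≤ 2 * (10 * (Real.exp (q / 10) - 1)) ^ 2 := by
  have hcs : ∀ i i', u i ⬝ᵥ u i' ≤ 2 * (j i * j i') := fun i i' => by
    refine abs_le_of_sq_le_sq' ?_ (by positivity) |>.2
    calc (u i ⬝ᵥ u i') ^ 2 ≤ (∑ r, u i r ^ 2) * ∑ r, u i' r ^ 2 :=
          Finset.sum_mul_sq_le_sq_mul_sq _ _ _
      _ = (u i ⬝ᵥ u i) * (u i' ⬝ᵥ u i') := by simp only [dotProduct, sq]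
      _ ≤ (2 * (j i : ℝ) ^ 2) * (2 * (j i' : ℝ) ^ 2) :=
          mul_le_mul (hu i) (hu i') (Finset.sum_nonneg fun r _ => mul_self_nonneg _)
            (by positivity)
      _ = _ := by ring
  have h0 : 0 ≤ ∑ i, p i * (j i : ℝ) :=
    Finset.sum_nonneg fun i _ => mul_nonneg (h.nonneg i) (Nat.cast_nonneg _)
  calc (∑ i, p i • u i) ⬝ᵥ (∑ i, p i • u i) = ∑ i, ∑ i', p i * p i' * (u i ⬝ᵥ u i') := by
        simp only [sum_dotProduct, dotProduct_sum, smul_dotProduct, dotProduct_smul, smul_eq_mul]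
        refine Finset.sum_congr rfl fun i _ => ?_
        rw [Finset.mul_sum]
        exact Finset.sum_congr rfl fun i' _ => by rw [dotProduct_comm, mul_assoc]
    _ ≤ ∑ i, ∑ i', p i * p i' * (2 * (j i * j i')) := by
        refine Finset.sum_le_sum fun i _ => Finset.sum_le_sum fun i' _ => ?_
        exact mul_le_mul_of_nonneg_left (hcs i i') (mul_nonneg (h.nonneg i) (h.nonneg i'))
    _ = 2 * (∑ i, p i * (j i : ℝ)) ^ 2 := by
        rw [sq, Finset.sum_mul_sum, Finset.mul_sum]
        refine Finset.sum_congr rfl fun i _ => ?_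
        rw [Finset.mul_sum]
        exact Finset.sum_congr rfl fun i' _ => by ring
    _ ≤ _ := by
        gcongr
        exact h.sum_mul_le

/-- The unshifted component against the mixture. -/
lemma shiftProb_zero_le (h : IsRare q p j) (hσ : 0 < σ) (hS : MeasurableSet S)
    (hu : ∀ i, u i ⬝ᵥ u i ≤ 2 * (j i : ℝ) ^ 2) {s : ℝ} (hs : 0 ≤ s) (τ : ℝ) :
    shiftProb σ S 0 ≤ Real.exp τ * ∑ i, p i * shiftProb σ S (u i) +
      Real.exp ((s * (Real.exp (2 * q) - 1) +
        s ^ 2 * (2 * (10 * (Real.exp (q / 10) - 1)) ^ 2)) / (2 * σ ^ 2) - s * τ) := by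
  refine (shiftProb_zero_le_sum_add hσ hS h.nonneg h.sum_eq_one u hs τ).trans ?_
  have h1 : ∑ i, p i * (u i ⬝ᵥ u i) ≤ Real.exp (2 * q) - 1 :=
    (Finset.sum_le_sum fun i _ => mul_le_mul_of_nonneg_left (hu i) (h.nonneg i)).trans
      h.sum_mul_sq_le
  have h2 := h.dotProduct_mean_le hu
  gcongr

end IsRare

/-! ### The constants -/

lemma exp_two_mul_sub_one_le {y : ℝ} (hy : 0 ≤ y) (hy1 : y ≤ 1) :
    Real.exp (2 * y) - 1 ≤ 6.4 * y := by
  have h := convexOn_exp.2 (Set.mem_univ 0) (Set.mem_univ 2) (sub_nonneg.2 hy1) hy (by ring)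
  simp only [smul_eq_mul, mul_zero, zero_add, Real.exp_zero, mul_one] at h
  rw [mul_comm y 2] at h
  have h2 : Real.exp 2 ≤ 7.4 := by
    rw [show (2 : ℝ) = 1 + 1 by norm_num, Real.exp_add]
    nlinarith [Real.exp_one_lt_d9, Real.exp_pos 1]
  nlinarith

lemma exp_sub_one_le_of_le {z : ℝ} (hz : 0 ≤ z) (hz1 : z ≤ 0.4) :
    Real.exp z - 1 ≤ 1.25 * z := by
  have h := Real.exp_bound' hz (by linarith) (n := 3) (by norm_num)
  norm_num [Finset.sum_range_succ, Nat.factorial] at h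
  nlinarith [mul_nonneg hz (sub_nonneg.2 hz1), mul_nonneg (mul_nonneg hz hz) (sub_nonneg.2 hz1)]

lemma exp_sub_one_le_of_le' {z : ℝ} (hz : 0 ≤ z) (hz1 : z ≤ 0.02) :
    Real.exp z - 1 ≤ 1.02 * z := by
  have h := Real.exp_bound' hz (by linarith) (n := 2) (by norm_num)
  norm_num [Finset.sum_range_succ, Nat.factorial] at h
  nlinarith [mul_nonneg hz (sub_nonneg.2 hz1)]

lemma le_log_one_div {δ : ℝ} (hδ : 0 < δ) (hδ' : δ < 0.2) : 1.6 ≤ Real.log (1 / δ) := by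
  rw [Real.le_log_iff_exp_le (by positivity)]
  have h := Real.exp_bound' (x := 0.4) (by norm_num) (by norm_num) (n := 4) (by norm_num)
  norm_num [Finset.sum_range_succ, Nat.factorial] at h
  have h5 : (5 : ℝ) ≤ 1 / δ := by
    rw [le_div_iff₀ hδ]
    linarith
  refine le_trans ?_ h5
  rw [show (1.6 : ℝ) = (4 : ℕ) * (2 / 5) by norm_num, Real.exp_nat_mul]
  calc Real.exp (2 / 5) ^ 4 ≤ 1.495 ^ 4 := by
        gcongr
        linarith
    _ ≤ 5 := by norm_num

lemma exp_mul_exp_sub_one_le {q y : ℝ} (hq : 0 ≤ q) (hq' : q ≤ 0.2) (hy : y ≤ 1) :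
    Real.exp (q * (Real.exp y - 1)) - (1 - q) ≤ 0.62 := by
  have h1 : Real.exp y - 1 ≤ 1.719 := by
    linarith [Real.exp_le_exp.2 hy, Real.exp_one_lt_d9]
  have h2 : q * (Real.exp y - 1) ≤ 0.3438 :=
    (mul_le_mul_of_nonneg_left h1 hq).trans (by linarith)
  have h := Real.exp_bound' (x := 0.3438) (by norm_num) (by norm_num) (n := 4) (by norm_num)
  norm_num [Finset.sum_range_succ, Nat.factorial] at h
  have h3 : Real.exp (q * (Real.exp y - 1)) ≤ Real.exp (1719 / 5000) :=
    Real.exp_le_exp.2 (by linarith)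
  linarith

namespace IsRare

variable {ι : Type*} [Fintype ι] {q : ℝ} {p : ι → ℝ} {j : ι → ℕ}
variable {R : ℕ} {σ : ℝ} {S : Set (Fin R → ℝ)} {u u' : ι → Fin R → ℝ}

/-- The differential privacy inequality for two mixtures with the same rare multiplicity. For
`δ ≥ 0.2` the total variation bound suffices. Otherwise `ε` is split into `12.8 γ y`, the cost of
passing from the first mixture to the unshifted law, and `6.79 γ y`, the cost of passing on to the
second mixture, where `y = √(log (1 / δ)) / σ ≤ 1`. -/
theorem sum_shiftProb_le_exp_mul_add (h : IsRare q p j) (hq : 0 ≤ q) {γ δ : ℝ} (hqγ : q ≤ 2 * γ)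
    (hγ : 0 < γ) (hγ' : γ ≤ 0.1) (hδ : 0 < δ) (hσ : 2 * Real.sqrt 5 ≤ σ)
    (hδσ : Real.log (1 / δ) ≤ σ ^ 2) (hS : MeasurableSet S)
    (hu : ∀ i, u i ⬝ᵥ u i ≤ 2 * (j i : ℝ) ^ 2) (hu' : ∀ i, u' i ⬝ᵥ u' i ≤ 2 * (j i : ℝ) ^ 2) :
    ∑ i, p i * shiftProb σ S (u i) ≤
      Real.exp (8 * (γ / σ) * Real.sqrt (6 * Real.log (1 / δ))) *
        ∑ i, p i * shiftProb σ S (u' i) + δ := by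
  have h5 : 0 < Real.sqrt 5 := by positivity
  have hσ0 : 0 < σ := by linarith
  have hσ20 : 20 ≤ σ ^ 2 := by
    have := pow_le_pow_left₀ (by positivity) hσ 2
    rw [mul_pow, Real.sq_sqrt (by norm_num)] at this
    linarith
  have hG' : 0 ≤ ∑ i, p i * shiftProb σ S (u' i) :=
    Finset.sum_nonneg fun i _ => mul_nonneg (h.nonneg i) (shiftProb_nonneg _ _ _)
  set L := Real.log (1 / δ) with hL
  rcases le_or_gt 0.2 δ with hδ2 | hδ2
  · refine (h.sum_shiftProb_le_add hu hu').trans (add_le_add ?_ (by linarith))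
    exact le_mul_of_one_le_left hG' (Real.one_le_exp (by positivity))
  have hL1 : 1.6 ≤ L := le_log_one_div hδ hδ2
  have hL0 : 0 < L := by linarith
  have hexpL : Real.exp (-L) = δ := by
    rw [hL, one_div, Real.log_inv, neg_neg, Real.exp_log hδ]
  set y := Real.sqrt L / σ with hy
  have hy0 : 0 < y := div_pos (Real.sqrt_pos.2 hL0) hσ0
  have hyL : y ^ 2 * σ ^ 2 = L := by
    rw [hy, div_pow, Real.sq_sqrt hL0.le, div_mul_cancel₀ _ (by positivity)]
  have hy1 : y ≤ 1 := by
    rw [hy, div_le_one hσ0]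
    exact Real.sqrt_le_iff.2 ⟨hσ0.le, hδσ⟩
  have hy5 : y ≤ L / 5 := by
    refine abs_le_of_sq_le_sq' ?_ (by positivity) |>.2
    nlinarith [sq_nonneg y]
  set τ := 6.79 * γ * y with hτ
  -- Nearly the optimal order: the Chernoff exponent is then `2 y + 2.67 L - 5.43 L`.
  set s := 0.8 * σ ^ 2 * y / γ with hs
  have hγy : γ * y ≤ 0.1 * y := by gcongr
  have h1 := h.sum_shiftProb_le hσ0 hS hu hy0
  have h2 := h.shiftProb_zero_le hσ0 hS hu' (s := s) (by positivity) τ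
  rw [hyL, hexpL] at h1
  have hE : Real.exp (q * (Real.exp (2 * y) - 1)) ≤ Real.exp (12.8 * γ * y) := by
    refine Real.exp_le_exp.2 ?_
    calc q * (Real.exp (2 * y) - 1) ≤ (2 * γ) * (6.4 * y) :=
          mul_le_mul hqγ (exp_two_mul_sub_one_le hy0.le hy1)
            (by linarith [Real.add_one_le_exp (2 * y)]) (by positivity)
      _ = _ := by ring
  have hε : 12.8 * γ * y + τ ≤ 8 * (γ / σ) * Real.sqrt (6 * L) := by
    have h6 : 2.449 ≤ Real.sqrt 6 := Real.le_sqrt_of_sq_le (by norm_num)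
    have : 8 * (γ / σ) * Real.sqrt (6 * L) = 8 * Real.sqrt 6 * (γ * y) := by
      rw [Real.sqrt_mul (by norm_num), hy]
      ring
    rw [this, hτ]
    nlinarith [mul_pos hγ hy0]
  have hd1 := exp_mul_exp_sub_one_le hq (by linarith : q ≤ 0.2) hy1
  -- The Chernoff bound of the second step, including the factor that the first step puts on it.
  have hd2 : 12.8 * γ * y + ((s * (Real.exp (2 * q) - 1) +
      s ^ 2 * (2 * (10 * (Real.exp (q / 10) - 1)) ^ 2)) / (2 * σ ^ 2) - s * τ) ≤ -L - 1 := by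
    have hM : Real.exp (2 * q) - 1 ≤ 5 * γ := by
      have := exp_sub_one_le_of_le (z := 2 * q) (by linarith) (by linarith)
      linarith
    have hm : 10 * (Real.exp (q / 10) - 1) ≤ 2.04 * γ := by
      have := exp_sub_one_le_of_le' (z := q / 10) (by linarith) (by linarith)
      linarith
    have hm0 : 0 ≤ 10 * (Real.exp (q / 10) - 1) := by
      linarith [Real.add_one_le_exp (q / 10)]
    have hb : (s * (Real.exp (2 * q) - 1) +
        s ^ 2 * (2 * (10 * (Real.exp (q / 10) - 1)) ^ 2)) / (2 * σ ^ 2) ≤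
        (s * (5 * γ) + s ^ 2 * (2 * (2.04 * γ) ^ 2)) / (2 * σ ^ 2) := by gcongr
    have hc : (s * (5 * γ) + s ^ 2 * (2 * (2.04 * γ) ^ 2)) / (2 * σ ^ 2) =
        2 * y + 2.663424 * L := by
      rw [hs, ← hyL]
      field_simp
      ring
    have hsτ : s * τ = 5.432 * L := by
      rw [hs, hτ, ← hyL]
      field_simp
      ring
    rw [hsτ]
    rw [hc] at hb
    linarith
  have he1 : Real.exp (-1) ≤ 0.37 := by
    rw [Real.exp_neg, inv_le_comm₀ (Real.exp_pos _) (by norm_num)]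
    linarith [Real.exp_one_gt_d9]
  set D := Real.exp ((s * (Real.exp (2 * q) - 1) +
    s ^ 2 * (2 * (10 * (Real.exp (q / 10) - 1)) ^ 2)) / (2 * σ ^ 2) - s * τ) with hD
  have hED : Real.exp (12.8 * γ * y) * D ≤ 0.37 * δ := by
    rw [hD, ← Real.exp_add]
    refine (Real.exp_le_exp.2 hd2).trans ?_
    rw [sub_eq_add_neg, Real.exp_add, hexpL, mul_comm]
    gcongr
  calc ∑ i, p i * shiftProb σ S (u i)
      ≤ Real.exp (12.8 * γ * y) * shiftProb σ S 0 + δ * 0.62 := by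
        refine h1.trans ?_
        gcongr
        exact shiftProb_nonneg _ _ _
    _ ≤ Real.exp (12.8 * γ * y) * (Real.exp τ * ∑ i, p i * shiftProb σ S (u' i) + D) +
          δ * 0.62 := by gcongr
    _ = Real.exp (12.8 * γ * y + τ) * ∑ i, p i * shiftProb σ S (u' i) +
          (Real.exp (12.8 * γ * y) * D + δ * 0.62) := by
        rw [Real.exp_add]
        ring
    _ ≤ _ := by
        gcongr
        linarith

end IsRare

/-! ### Independent draws -/

/-- Conditioning on the first of `k + 1` independent draws. -/
lemma sum_prod_mul_comp_succ {α ι : Type*} [Fintype ι] (p : ι → ℝ) (x : ι → α) (k : ℕ)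
    (F : (Fin (k + 1) → α) → ℝ) :
    ∑ t : Fin (k + 1) → ι, (∏ l, p (t l)) * F (fun l => x (t l)) =
      ∑ i, p i * ∑ t : Fin k → ι, (∏ l, p (t l)) * F (Fin.cons (x i) fun l => x (t l)) := by
  rw [← (Fin.consEquiv fun _ => ι).sum_comp, Fintype.sum_prod_type]
  refine Finset.sum_congr rfl fun i _ => ?_
  rw [Finset.mul_sum]
  refine Finset.sum_congr rfl fun t _ => ?_
  simp only [Fin.consEquiv_apply, Fin.prod_univ_succ, Fin.cons_zero, Fin.cons_succ, mul_assoc]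
  congr 3
  ext l
  refine Fin.cases ?_ (fun l => ?_) l <;> simp

/-- A function of `k` independent draws has the same mean for two descriptions of the law of a
single draw. -/
lemma sum_prod_mul_comp_eq {α ι κ : Type*} [Fintype ι] [Fintype κ] {p : ι → ℝ} {x : ι → α}
    {p' : κ → ℝ} {x' : κ → α} (h : ∀ f : α → ℝ, ∑ i, p i * f (x i) = ∑ i, p' i * f (x' i))
    (k : ℕ) (F : (Fin k → α) → ℝ) :
    ∑ t : Fin k → ι, (∏ l, p (t l)) * F (fun l => x (t l)) =
      ∑ t : Fin k → κ, (∏ l, p' (t l)) * F (fun l => x' (t l)) := by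
  induction k with
  | zero =>
    simp only [Finset.univ_unique, Finset.sum_singleton, Finset.univ_eq_empty, Finset.prod_empty]
    congr 2
    exact Subsingleton.elim _ _
  | succ k ih =>
    rw [sum_prod_mul_comp_succ, sum_prod_mul_comp_succ,
      h fun a => ∑ t : Fin k → ι, (∏ l, p (t l)) * F (Fin.cons a fun l => x (t l))]
    exact Finset.sum_congr rfl fun i _ => congrArg _ (ih fun y => F (Fin.cons (x' i) y))

/-- The law of the noisy scores is a finite mixture of translates of the noise, one for each tuple
of drawn positions. -/
lemma scoring_apply {𝒳 : Type*} {R : ℕ} (a : 𝒳 → Fin R) (k : ℕ) (σ : ℝ) {X : List 𝒳}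
    (hX : X.length ≠ 0) {S : Set (Fin R → ℝ)} (hS : MeasurableSet S) :
    scoring a k σ X S = ENNReal.ofReal (∑ t : Fin k → Fin X.length,
      (∏ _l : Fin k, (X.length : ℝ)⁻¹) *
        shiftProb σ S fun r => (coverage a (fun l => X.get (t l)) r : ℝ)) := by
  have hf : Measurable fun (p : (Fin k → Fin X.length) × (Fin R → ℝ)) r =>
      (coverage a (fun i => X.get (p.1 i)) r : ℝ) + p.2 r := by
    refine measurable_pi_iff.2 fun r => ?_
    refine Measurable.add ?_ ((measurable_pi_apply r).comp measurable_snd)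
    exact (measurable_of_countable
      (fun t : Fin k → Fin X.length => (coverage a (fun i => X.get (t i)) r : ℝ))).comp measurable_fst
  rw [scoring, Measure.map_apply hf hS, Measure.prod_apply (hf hS), lintegral_fintype,
    ENNReal.ofReal_sum_of_nonneg fun t _ =>
      mul_nonneg (by positivity) (shiftProb_nonneg _ _ _)]
  refine Finset.sum_congr rfl fun t _ => ?_
  rw [mul_comm, ENNReal.ofReal_mul (by positivity), shiftProb,
    map_measureReal_apply (measurable_const_add _) hS, ofReal_measureReal]
  congr 1
  rw [drawLaw, uniformOn_univ, Measure.count_singleton]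
  simp only [Finset.prod_const, Finset.card_univ, Fintype.card_fin, Fintype.card_fun]
  have hX0 : (0 : ℝ) < X.length := by exact_mod_cast Nat.pos_of_ne_zero hX
  rw [ENNReal.ofReal_pow (inv_nonneg.2 hX0.le), ENNReal.ofReal_inv_of_pos hX0,
    ENNReal.ofReal_natCast, ← ENNReal.inv_pow, one_div, Nat.cast_pow]

/-- The law of the set of draws that hit one given position out of `n`, as a vector of
independent Bernoulli variables. -/
def hitProb (k n : ℕ) (b : Fin k → Bool) : ℝ :=
  ∏ l, if b l then (n : ℝ)⁻¹ else 1 - (n : ℝ)⁻¹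

/-- The number of draws that hit. -/
def hits {k : ℕ} (b : Fin k → Bool) : ℕ := (Finset.univ.filter fun l => b l).card

lemma sum_hitProb_mul_pow (k n : ℕ) (t : ℝ) :
    ∑ b, hitProb k n b * t ^ hits b = (1 + (t - 1) * (n : ℝ)⁻¹) ^ k := by
  have h1 : ∀ b : Fin k → Bool, hitProb k n b * t ^ hits b =
      ∏ l, if b l then t * (n : ℝ)⁻¹ else 1 - (n : ℝ)⁻¹ := fun b => by
    rw [hitProb, hits, Finset.card_filter, ← Finset.prod_pow_eq_pow_sum, ← Finset.prod_mul_distrib]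
    refine Finset.prod_congr rfl fun l _ => ?_
    cases b l <;> simp [mul_comm]
  simp only [h1]
  rw [← Fintype.sum_pow (fun c : Bool => if c then t * (n : ℝ)⁻¹ else 1 - (n : ℝ)⁻¹)]
  congr 1
  simp
  ring

lemma isRare_hitProb (k : ℕ) {n : ℕ} (hn : n ≠ 0) :
    IsRare ((k : ℝ) / n) (hitProb k n) (hits (k := k)) where
  nonneg b := by
    refine Finset.prod_nonneg fun l _ => ?_
    have : (n : ℝ)⁻¹ ≤ 1 := inv_le_one_of_one_le₀ (by exact_mod_cast Nat.one_le_iff_ne_zero.2 hn)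
    split_ifs
    · positivity
    · linarith
  sum_eq_one := by simpa using sum_hitProb_mul_pow k n 1
  sum_mul_pow_le t ht := by
    have : (n : ℝ)⁻¹ ≤ 1 := inv_le_one_of_one_le₀ (by exact_mod_cast Nat.one_le_iff_ne_zero.2 hn)
    have h0 : (0 : ℝ) ≤ (n : ℝ)⁻¹ := by positivity
    rw [sum_hitProb_mul_pow, show (k : ℝ) / n * (t - 1) = k * ((t - 1) * (n : ℝ)⁻¹) by ring,
      Real.exp_nat_mul]
    refine pow_le_pow_left₀ (by nlinarith) ?_ k
    rw [add_comm]
    exact Real.add_one_le_exp _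
  one_sub_le := by
    have : (n : ℝ)⁻¹ ≤ 1 := inv_le_one_of_one_le₀ (by exact_mod_cast Nat.one_le_iff_ne_zero.2 hn)
    rw [sum_hitProb_mul_pow]
    have := one_add_mul_le_pow (a := (0 - 1) * (n : ℝ)⁻¹) (by linarith) k
    refine le_trans (le_of_eq ?_) this
    ring

/-- The change of the coverage scores when `x` is substituted for the entries of `y` at which `b`
hits. -/
def hitShift {𝒳 : Type*} {R k : ℕ} (a : 𝒳 → Fin R) (y : Fin k → 𝒳) (x : 𝒳) (b : Fin k → Bool)
    (r : Fin R) : ℝ :=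
  (coverage a (fun l => if b l then x else y l) r : ℝ) - coverage a y r

/-- The shift is a difference of two nonnegative vectors, each of which has sum `hits b`. -/
lemma hitShift_dotProduct_self_le {𝒳 : Type*} {R k : ℕ} (a : 𝒳 → Fin R) (y : Fin k → 𝒳) (x : 𝒳)
    (b : Fin k → Bool) :
    hitShift a y x b ⬝ᵥ hitShift a y x b ≤ 2 * (hits b : ℝ) ^ 2 := by
  set A : (Fin k → 𝒳) → Fin R → ℝ := fun y r =>
    (((Finset.univ.filter fun l => b l).filter fun l => a (y l) = r).card : ℝ) with hA
  have hsum : ∀ y, ∑ r, A y r = hits b := fun y => by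
    rw [hA, hits, ← Nat.cast_sum]
    exact_mod_cast (Finset.card_eq_sum_card_fiberwise fun l _ => Finset.mem_univ (a (y l))).symm
  have hA0 : ∀ y r, 0 ≤ A y r := fun y r => Nat.cast_nonneg _
  have hle : ∀ y r, A y r ≤ hits b := fun y r =>
    Nat.cast_le.2 (Finset.card_le_card (Finset.filter_subset _ _))
  have hsplit : ∀ (y : Fin k → 𝒳) r, (coverage a y r : ℝ) = A y r +
      (((Finset.univ.filter fun l => ¬ b l).filter fun l => a (y l) = r).card : ℝ) := fun y r => by
    rw [hA, coverage, ← Nat.cast_add, Finset.filter_comm, Finset.filter_comm (fun l => ¬ b l = true),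
      Finset.card_filter_add_card_filter_not]
  have hdiff : ∀ r, hitShift a y x b r = A (fun l => if b l then x else y l) r - A y r := fun r => by
    rw [hitShift, hsplit, hsplit]
    have : ((Finset.univ.filter fun l => ¬ b l).filter
        fun l => a (if b l then x else y l) = r) =
        ((Finset.univ.filter fun l => ¬ b l).filter fun l => a (y l) = r) := by
      refine Finset.filter_congr fun l hl => ?_
      rw [if_neg (Finset.mem_filter.1 hl).2]
    rw [this]
    ring
  have hterm : ∀ r, hitShift a y x b r * hitShift a y x b r ≤
      hits b * A (fun l => if b l then x else y l) r + hits b * A y r := fun r => by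
    rw [hdiff]
    nlinarith [hA0 y r, hA0 (fun l => if b l then x else y l) r, hle y r,
      hle (fun l => if b l then x else y l) r,
      mul_nonneg (hA0 y r) (hA0 (fun l => if b l then x else y l) r)]
  refine (Finset.sum_le_sum fun r _ => hterm r).trans (le_of_eq ?_)
  rw [Finset.sum_add_distrib, ← Finset.mul_sum, ← Finset.mul_sum, hsum, hsum]
  ring

/-- A uniform draw from a list is, with the probability of the position of `x`, the sample `x`, and
otherwise a uniform draw from the remaining list. -/
lemma sum_get_eq {𝒳 : Type*} (l₁ l₂ : List 𝒳) (x : 𝒳) (hl : (l₁ ++ l₂).length ≠ 0) (f : 𝒳 → ℝ) :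
    ∑ i, ((l₁ ++ x :: l₂).length : ℝ)⁻¹ * f ((l₁ ++ x :: l₂).get i) =
      ∑ c : Bool × Fin (l₁ ++ l₂).length,
        ((if c.1 then ((l₁ ++ x :: l₂).length : ℝ)⁻¹ else 1 - ((l₁ ++ x :: l₂).length : ℝ)⁻¹) *
          ((l₁ ++ l₂).length : ℝ)⁻¹) * f (if c.1 then x else (l₁ ++ l₂).get c.2) := by
  have hsum : ∀ l : List 𝒳, ∑ i, f (l.get i) = (l.map f).sum := fun l => by
    simp [← Fin.sum_univ_fun_getElem]
  have hm : ((l₁ ++ l₂).length : ℝ) ≠ 0 := by exact_mod_cast hl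
  have hN : ((l₁ ++ x :: l₂).length : ℝ) = (l₁ ++ l₂).length + 1 := by
    simp only [List.length_append, List.length_cons]
    push_cast
    ring
  have hN0 : ((l₁ ++ l₂).length : ℝ) + 1 ≠ 0 := by positivity
  rw [← Finset.mul_sum, hsum, Fintype.sum_prod_type]
  simp only [Fintype.sum_bool, if_true, Bool.false_eq_true, if_false, ← Finset.mul_sum, hsum,
    Finset.sum_const, Finset.card_univ, Fintype.card_fin, nsmul_eq_mul, hN]
  simp only [List.map_append, List.map_cons, List.sum_append, List.sum_cons]
  field_simp
  ring

/-! ### The scoring mechanism on neighboring datasets -/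

/-- The law of the noisy scores as a mixture over `k` draws from the list without `x`, and over the
set of draws that are then redirected to `x`. -/
lemma scoring_insert_apply {𝒳 : Type*} {R : ℕ} (a : 𝒳 → Fin R) (k : ℕ) (σ : ℝ) (l₁ l₂ : List 𝒳)
    (x : 𝒳) (hl : (l₁ ++ l₂).length ≠ 0) {S : Set (Fin R → ℝ)} (hS : MeasurableSet S) :
    scoring a k σ (l₁ ++ x :: l₂) S = ENNReal.ofReal (∑ t : Fin k → Fin (l₁ ++ l₂).length,
      (∏ _l : Fin k, ((l₁ ++ l₂).length : ℝ)⁻¹) *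
        ∑ b, hitProb k (l₁ ++ x :: l₂).length b *
          shiftProb σ ((fun z r => (coverage a (fun l => (l₁ ++ l₂).get (t l)) r : ℝ) + z r) ⁻¹' S)
            (hitShift a (fun l => (l₁ ++ l₂).get (t l)) x b)) := by
  rw [scoring_apply a k σ (by simp) hS]
  congr 1
  have h := sum_prod_mul_comp_eq (p := fun _ => ((l₁ ++ x :: l₂).length : ℝ)⁻¹)
    (x := (l₁ ++ x :: l₂).get) (sum_get_eq l₁ l₂ x hl) k
    (fun y => shiftProb σ S fun r => (coverage a y r : ℝ))
  rw [h, ← (Equiv.arrowProdEquivProdArrow (Fin k) (fun _ => Bool)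
    fun _ => Fin (l₁ ++ l₂).length).symm.sum_comp, Fintype.sum_prod_type, Finset.sum_comm]
  refine Finset.sum_congr rfl fun t _ => ?_
  rw [Finset.mul_sum]
  refine Finset.sum_congr rfl fun b _ => ?_
  have hshift : ∀ y : Fin k → 𝒳, shiftProb σ ((fun z r => (coverage a y r : ℝ) + z r) ⁻¹' S)
      (hitShift a y x b) =
      shiftProb σ S fun r => (coverage a (fun l => if b l then x else y l) r : ℝ) := fun y => by
    have := shiftProb_add σ hS (fun r => (coverage a y r : ℝ)) (hitShift a y x b)
    rw [show (fun z r => (coverage a y r : ℝ) + z r) = ((fun r => (coverage a y r : ℝ)) + ·) from rfl,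
      ← this]
    congr 1
    ext r
    simp [hitShift]
  rw [hshift, hitProb, ← mul_assoc, ← Finset.prod_mul_distrib]
  simp only [Equiv.arrowProdEquivProdArrow_symm_apply, mul_comm]

/-- The law of the noisy scores of the list without `x`, in the form of `scoring_insert_apply`. -/
lemma scoring_remove_apply {𝒳 : Type*} {R : ℕ} (a : 𝒳 → Fin R) (k : ℕ) (σ : ℝ) (X : List 𝒳)
    (hl : X.length ≠ 0) {n : ℕ} (hn : n ≠ 0) {S : Set (Fin R → ℝ)} (hS : MeasurableSet S) :
    scoring a k σ X S = ENNReal.ofReal (∑ t : Fin k → Fin X.length,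
      (∏ _l : Fin k, (X.length : ℝ)⁻¹) *
        ∑ b, hitProb k n b *
          shiftProb σ ((fun z r => (coverage a (fun l => X.get (t l)) r : ℝ) + z r) ⁻¹' S) 0) := by
  rw [scoring_apply a k σ hl hS]
  congr 1
  refine Finset.sum_congr rfl fun t _ => ?_
  rw [← Finset.sum_mul, (isRare_hitProb k hn).sum_eq_one, one_mul]
  have := shiftProb_add σ hS (fun r => (coverage a (fun l => X.get (t l)) r : ℝ)) 0
  rw [add_zero] at this
  rw [this]
  rfl

/-- Inequalities between the parts of two mixtures add up. -/
lemma ofReal_sum_le {ι : Type*} [Fintype ι] {w A B : ι → ℝ} {C δ : ℝ} (hw : ∀ i, 0 ≤ w i)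
    (hw1 : ∑ i, w i = 1) (hC : 0 ≤ C) (hδ : 0 ≤ δ) (hB : ∀ i, 0 ≤ B i)
    (h : ∀ i, A i ≤ C * B i + δ) :
    ENNReal.ofReal (∑ i, w i * A i) ≤
      ENNReal.ofReal C * ENNReal.ofReal (∑ i, w i * B i) + ENNReal.ofReal δ := by
  have h0 : 0 ≤ ∑ i, w i * B i := Finset.sum_nonneg fun i _ => mul_nonneg (hw i) (hB i)
  rw [← ENNReal.ofReal_mul hC, ← ENNReal.ofReal_add (mul_nonneg hC h0) hδ]
  refine ENNReal.ofReal_le_ofReal ?_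
  calc ∑ i, w i * A i ≤ ∑ i, w i * (C * B i + δ) :=
        Finset.sum_le_sum fun i _ => mul_le_mul_of_nonneg_left (h i) (hw i)
    _ = C * ∑ i, w i * B i + δ := by
        rw [Finset.mul_sum]
        simp only [mul_add, Finset.sum_add_distrib]
        rw [← Finset.sum_mul, hw1, one_mul]
        congr 1
        exact Finset.sum_congr rfl fun i _ => by ring

end ECOS
end

theorem mainTheorem2 {𝒳 : Type*} {d R : ℕ} (φ : 𝒳 → EuclideanSpace ℝ (Fin d))
    (c : Fin R → EuclideanSpace ℝ (Fin d)) (a : 𝒳 → Fin R)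
    (ha : ECOS.IsCentroidPartition φ c a)
    (n : ℕ) (γ σ δ : ℝ) (hγ : 0 < γ) (hδ : 0 < δ) (hσ : 2 * Real.sqrt 5 ≤ σ)
    (hγ' : γ ≤ min 0.1 (σ * Real.sqrt (Real.log (1 / δ) / 6)))
    (hn : 1 ≤ γ * n) (hδσ : Real.log (1 / δ) ≤ σ ^ 2) :
    ECOS.IsDP (ECOS.Neighboring n) (ECOS.scoring a ⌈γ * n⌉₊ σ)
      (8 * (γ / σ) * Real.sqrt (6 * Real.log (1 / δ))) δ := by
  have hγ1 : γ ≤ 0.1 := hγ'.trans (min_le_left _ _)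
  have hn10 : (10 : ℝ) ≤ n := by nlinarith
  have hn2 : 10 ≤ n := by exact_mod_cast hn10
  have hn0 : n ≠ 0 := by omega
  set k := ⌈γ * n⌉₊ with hk
  have hq : (k : ℝ) / n ≤ 2 * γ := by
    rw [div_le_iff₀ (by linarith)]
    have := Nat.ceil_lt_add_one (a := γ * n) (by linarith)
    linarith
  have hrare := ECOS.isRare_hitProb k hn0
  -- Any two shifts of the same draws from the common part of the two datasets are compared.
  have main : ∀ (X : List 𝒳) (S : Set (Fin R → ℝ)), X.length ≠ 0 → MeasurableSet S →
      ∀ u u' : (Fin k → 𝒳) → (Fin k → Bool) → Fin R → ℝ,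
      (∀ y b, u y b ⬝ᵥ u y b ≤ 2 * (ECOS.hits b : ℝ) ^ 2) →
      (∀ y b, u' y b ⬝ᵥ u' y b ≤ 2 * (ECOS.hits b : ℝ) ^ 2) →
      ENNReal.ofReal (∑ t : Fin k → Fin X.length, (∏ _l : Fin k, (X.length : ℝ)⁻¹) *
        ∑ b, ECOS.hitProb k n b * ECOS.shiftProb σ
          ((fun z r => (ECOS.coverage a (fun l => X.get (t l)) r : ℝ) + z r) ⁻¹' S)
            (u (fun l => X.get (t l)) b)) ≤
      ENNReal.ofReal (Real.exp (8 * (γ / σ) * Real.sqrt (6 * Real.log (1 / δ)))) *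
        ENNReal.ofReal (∑ t : Fin k → Fin X.length, (∏ _l : Fin k, (X.length : ℝ)⁻¹) *
          ∑ b, ECOS.hitProb k n b * ECOS.shiftProb σ
            ((fun z r => (ECOS.coverage a (fun l => X.get (t l)) r : ℝ) + z r) ⁻¹' S)
              (u' (fun l => X.get (t l)) b)) + ENNReal.ofReal δ := by
    intro X S hX hS u u' hu hu'
    have hX0 : (X.length : ℝ) ≠ 0 := by exact_mod_cast hX
    refine ECOS.ofReal_sum_le (fun t => by positivity) ?_ (Real.exp_pos _).le hδ.le
      (fun t => Finset.sum_nonneg fun b _ =>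
        mul_nonneg (hrare.nonneg b) (ECOS.shiftProb_nonneg _ _ _))
      fun t => hrare.sum_shiftProb_le_exp_mul_add (by positivity) hq hγ hγ1 hδ hσ hδσ ?_
        (hu _) (hu' _)
    · simp [hX0]
    · exact measurable_const_add
        (fun r => (ECOS.coverage a (fun l => X.get (t l)) r : ℝ)) hS
  have hzero : ∀ (y : Fin k → 𝒳) (b : Fin k → Bool),
      (0 : Fin R → ℝ) ⬝ᵥ 0 ≤ 2 * (ECOS.hits b : ℝ) ^ 2 := fun y b => by
    rw [dotProduct_zero]
    positivity
  intro X X' hN S hS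
  cases hN with
  | replace l₁ l₂ x x' h =>
    have hl : (l₁ ++ l₂).length ≠ 0 := by
      simp only [List.length_append, List.length_cons] at h ⊢
      omega
    have h' : (l₁ ++ x' :: l₂).length = n := by simpa using h
    rw [ECOS.scoring_insert_apply a k σ l₁ l₂ x hl hS,
      ECOS.scoring_insert_apply a k σ l₁ l₂ x' hl hS, h, h']
    exact main _ S hl hS (fun y b => ECOS.hitShift a y x b) (fun y b => ECOS.hitShift a y x' b)
      (fun y b => ECOS.hitShift_dotProduct_self_le a y x b)
      (fun y b => ECOS.hitShift_dotProduct_self_le a y x' b)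
  | remove l₁ l₂ x h =>
    have hl : (l₁ ++ l₂).length ≠ 0 := by
      simp only [List.length_append, List.length_cons] at h ⊢
      omega
    rw [ECOS.scoring_insert_apply a k σ l₁ l₂ x hl hS,
      ECOS.scoring_remove_apply a k σ _ hl hn0 hS, h]
    exact main _ S hl hS (fun y b => ECOS.hitShift a y x b) (fun y b => 0)
      (fun y b => ECOS.hitShift_dotProduct_self_le a y x b) hzero
  | insert l₁ l₂ x h =>
    have hl : (l₁ ++ l₂).length ≠ 0 := by
      simp only [List.length_append, List.length_cons] at h ⊢
      omega
    rw [ECOS.scoring_insert_apply a k σ l₁ l₂ x hl hS,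
      ECOS.scoring_remove_apply a k σ _ hl hn0 hS, h]
    exact main _ S hl hS (fun y b => 0) (fun y b => ECOS.hitShift a y x b) hzero
      (fun y b => ECOS.hitShift_dotProduct_self_le a y x b)
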